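/- For integers $p,q>1$ and $n\ge 1$ let $f_{p,q}(n)$ be the number of different expressions of $n$ as a sum of distinct terms taken from $\{p^{\alpha}q^{\beta}:\alpha,\beta\in\mathbb{Z}_{\ge 0}\}$ (the order of the terms being irrelevant). Let $q_2>q_1>p>1$ be integers with $\gcd(p,q_1)=\gcd(p,q_2)=1$. Then $$\lim_{n\to\infty}\frac{f_{p,q_2}(n)}{f_{p,q_1}(n)}=0.$$ In particular, $f_{p,q_1}(n)>f_{p,q_2}(n)$ for all sufficiently large $n$. -/

import Mathlib

open Filter Topology

/-- The finite sets of terms `p ^ α * q ^ β` (with `α, β ∈ ℕ`) whose sum is `n`, that is, the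
expressions of `n` as a sum of distinct terms from `{p ^ α * q ^ β : α, β ∈ ℕ}`. -/
def representations (p q n : ℕ) : Set (Finset ℕ) :=
  {S | (∀ m ∈ S, ∃ α β : ℕ, m = p ^ α * q ^ β) ∧ ∑ m ∈ S, m = n}

/-- There are finitely many such expressions, so that counting them by
`Set.ncard` is meaningful. -/
theorem representations_finite (p q n : ℕ) :
    (representations p q n).Finite := by
  refine (Finset.finite_toSet (Finset.range (n + 1)).powerset).subset ?_
  rintro S ⟨-, hS⟩
  simp only [Finset.mem_coe, Finset.mem_powerset]
  intro m hm
  have h : m ≤ ∑ k ∈ S, k := Finset.single_le_sum (f := fun k : ℕ => k) (fun _ _ => Nat.zero_le _) hm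
  simp only [Finset.mem_range]
  omega

/-- `f_{p,q}(n)`: the number of expressions of `n` as a sum of distinct terms taken from
`{p ^ α * q ^ β : α, β ∈ ℕ}`. -/
noncomputable def reprCount (p q n : ℕ) : ℕ := (representations p q n).ncard

/-!
The argument has two parts: a strong form of Birch's theorem, which shows that few of the terms
`p ^ i * q ^ j` already represent every large integer, and a count of the remaining terms.

*Few terms suffice* (`exists_termSum_eq`). The `p` rows `j < p` are dense enough for the greedy
algorithm to approximate every integer from below up to a bounded error (`exists_rows_near`). To
remove the error, one needs pairs of sums with one fixed difference `d`, arbitrarily far out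
(`exists_far_pair`). Choose `p ^ N * x = q ^ N * y + 1` and approximate the multiples `n * x` by
rows and `n * y` by columns. As the pair of errors takes boundedly many values, two multiples with
a bounded difference of indices `k > 0` have the same errors, so `k * x` is exactly a difference of
two sums in rows and `k * y` one of two sums in columns; then
`k = p ^ N * (k * x) - q ^ N * (k * y)` is a difference of two sums of far terms, and the bound on
`k` does not depend on `N`. Disjoint pairs with difference `d` give long arithmetic progressions of
sums, and finitely many powers of `p` and `q` cover all residues modulo `d`. Every term used has
`j < H` for a constant `H`.

*Counting.* A representation of `n` is a set of terms at most `n`, so `reprCount p q₂ n` is at most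
`2 ^ M`, where `M` is the number of these terms (`reprCount_le`). Conversely, any set of terms with
`j ≥ H` and sum at most `n / 2` extends to a representation by terms with `j < H`, so
`reprCount p q₁ n` is at least `2 ^ m`, where `m` is the size of a set of such terms with total at
most `n / 2` (`two_pow_card_le_reprCount`). Since `q₁ < q₂`, this set may have in its row `j + H`
about `j / D` terms more than row `j` has for `q₂`, up to a constant loss `A` in each row
(`exists_rows_sum_le`). There are about `log n` rows, so `m - M` tends to infinity.
-/

/-- The sum of the terms `p ^ i * q ^ j` over the exponent pairs `(i, j)` in `T`. Working with
exponent pairs instead of values makes disjointness a matter of comparing coordinates. -/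
def termSum (p q : ℕ) (T : Finset (ℕ × ℕ)) : ℕ := ∑ u ∈ T, p ^ u.1 * q ^ u.2

theorem termSum_union {p q : ℕ} {S T : Finset (ℕ × ℕ)} (h : Disjoint S T) :
    termSum p q (S ∪ T) = termSum p q S + termSum p q T :=
  Finset.sum_union h

theorem termSum_mono {p q : ℕ} {S T : Finset (ℕ × ℕ)} (h : S ⊆ T) :
    termSum p q S ≤ termSum p q T :=
  Finset.sum_le_sum_of_subset h

/-- Translate every exponent pair by `(a, b)`. -/
def shift (a b : ℕ) (T : Finset (ℕ × ℕ)) : Finset (ℕ × ℕ) :=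
  T.image fun u => (u.1 + a, u.2 + b)

theorem termSum_shift (p q a b : ℕ) (T : Finset (ℕ × ℕ)) :
    termSum p q (shift a b T) = p ^ a * q ^ b * termSum p q T := by
  unfold termSum shift
  rw [Finset.sum_image, Finset.mul_sum]
  · refine Finset.sum_congr rfl fun u _ => ?_
    ring
  · rintro ⟨a₁, b₁⟩ - ⟨a₂, b₂⟩ - h
    simpa using h

theorem mem_shift {a b : ℕ} {T : Finset (ℕ × ℕ)} {u : ℕ × ℕ} (h : u ∈ shift a b T) :
    ∃ v ∈ T, u.1 = v.1 + a ∧ u.2 = v.2 + b := by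
  obtain ⟨v, hv, rfl⟩ := Finset.mem_image.1 h
  exact ⟨v, hv, rfl, rfl⟩

/-! ### Greedy approximation by subset sums -/

/-- If every weight is at most `C` plus the sum of all strictly smaller weights, then subset sums
leave no gap longer than `C`: take the largest weight whenever the smaller ones do not suffice. -/
theorem exists_subset_sum_near {ι : Type*} [DecidableEq ι] (w : ι → ℕ) (C : ℕ) (s : Finset ι) :
    (∀ t ∈ s, w t ≤ C + ∑ u ∈ s with w u < w t, w u) →
      ∀ x < C + ∑ u ∈ s, w u, ∃ T ⊆ s, ∑ u ∈ T, w u ≤ x ∧ x < ∑ u ∈ T, w u + C := by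
  induction s using Finset.induction_on_max_value w with
  | empty =>
    intro _ x hx
    exact ⟨∅, subset_rfl, by simp, by simpa using hx⟩
  | insert a s ha hmax ih =>
    intro h x hx
    have hs : ∀ t ∈ s, w t ≤ C + ∑ u ∈ s with w u < w t, w u := by
      intro t ht
      have := h t (Finset.mem_insert_of_mem ht)
      rwa [Finset.filter_insert, if_neg (not_lt.2 (hmax t ht))] at this
    rw [Finset.sum_insert ha] at hx
    by_cases hxs : x < C + ∑ u ∈ s, w u
    · obtain ⟨T, hT, h1⟩ := ih hs x hxs
      exact ⟨T, hT.trans (Finset.subset_insert _ _), h1⟩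
    · have hwa : w a ≤ C + ∑ u ∈ s, w u := by
        refine (h a (Finset.mem_insert_self _ _)).trans ?_
        rw [Finset.filter_insert, if_neg (lt_irrefl _)]
        exact Nat.add_le_add_left (Finset.sum_le_sum_of_subset (Finset.filter_subset _ _)) _
      obtain ⟨T, hT, h1, h2⟩ := ih hs (x - w a) (by omega)
      have haT : a ∉ T := fun h => ha (hT h)
      refine ⟨insert a T, Finset.insert_subset_insert _ hT, ?_, ?_⟩ <;>
      rw [Finset.sum_insert haT] <;> omega

/-- Each of the `p` rows `j < p` contains a term in `[Y / p, Y)`, so that together the terms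
below `Y` sum to at least `Y`. -/
theorem le_sum_rows {p q : ℕ} (hp : 1 < p) (hq : 1 < q) (Y : ℕ) :
    Y ≤ q ^ p + ∑ u ∈ Finset.range Y ×ˢ Finset.range p with p ^ u.1 * q ^ u.2 < Y,
      p ^ u.1 * q ^ u.2 := by
  rcases le_or_gt Y (q ^ p) with hY | hY
  · omega
  have key : ∀ j, ∃ i, j < p → p ^ i * q ^ j < Y ∧ Y ≤ p ^ (i + 1) * q ^ j := by
    intro j
    by_cases hj : j < p
    · have hex : ∃ i, Y ≤ p ^ i * q ^ j :=
        ⟨Y, (Nat.lt_pow_self hp).le.trans (Nat.le_mul_of_pos_right _ (by positivity))⟩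
      have h0 : Nat.find hex ≠ 0 := by
        intro h0
        have h1 := Nat.find_spec hex
        rw [h0, pow_zero, one_mul] at h1
        have h2 : q ^ j ≤ q ^ p := Nat.pow_le_pow_right (by omega) hj.le
        omega
      obtain ⟨i, hi⟩ := Nat.exists_eq_succ_of_ne_zero h0
      refine ⟨i, fun _ => ⟨?_, ?_⟩⟩
      · exact not_le.1 (Nat.find_min hex (m := i) (by omega))
      · have h1 := Nat.find_spec hex
        rwa [hi] at h1
    · exact ⟨0, fun h => absurd h hj⟩
  choose i hi using key
  have hsub : (Finset.range p).image (fun j => (i j, j)) ⊆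
      (Finset.range Y ×ˢ Finset.range p).filter (fun u => p ^ u.1 * q ^ u.2 < Y) := by
    intro u hu
    obtain ⟨j, hj, rfl⟩ := Finset.mem_image.1 hu
    have hj' := Finset.mem_range.1 hj
    have h1 := (hi j hj').1
    have h2 : i j < p ^ i j := Nat.lt_pow_self hp
    have h3 : p ^ i j ≤ p ^ i j * q ^ j := Nat.le_mul_of_pos_right _ (by positivity)
    simp only [Finset.mem_filter, Finset.mem_product, Finset.mem_range]
    exact ⟨⟨by omega, hj'⟩, h1⟩
  have h1 := Finset.sum_le_sum_of_subset (f := fun u : ℕ × ℕ => p ^ u.1 * q ^ u.2) hsub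
  rw [Finset.sum_image (fun a _ b _ h => (Prod.ext_iff.1 h).2)] at h1
  have h2 : p * Y ≤ p * ∑ j ∈ Finset.range p, p ^ i j * q ^ j := by
    rw [Finset.mul_sum]
    calc p * Y = ∑ j ∈ Finset.range p, Y := by simp
      _ ≤ _ := Finset.sum_le_sum fun j hj => by
        have := (hi j (Finset.mem_range.1 hj)).2
        rw [pow_succ] at this
        linarith [this, mul_comm (p ^ i j) p, mul_assoc p (p ^ i j) (q ^ j)]
  have h3 := Nat.le_of_mul_le_mul_left h2 (by omega)
  exact h3.trans (h1.trans (Nat.le_add_left _ _))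

theorem exists_rows_near {p q : ℕ} (hp : 1 < p) (hq : 1 < q) (x : ℕ) :
    ∃ T : Finset (ℕ × ℕ), (∀ u ∈ T, u.2 < p) ∧ termSum p q T ≤ x ∧ x < termSum p q T + q ^ p := by
  set s := (Finset.range (x + 1) ×ˢ Finset.range p).filter
    (fun u : ℕ × ℕ => p ^ u.1 * q ^ u.2 < x + 1) with hs
  have hgreedy : ∀ t ∈ s, p ^ t.1 * q ^ t.2 ≤ q ^ p +
      ∑ u ∈ s with p ^ u.1 * q ^ u.2 < p ^ t.1 * q ^ t.2, p ^ u.1 * q ^ u.2 := by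
    intro t ht
    refine (le_sum_rows hp hq _).trans (Nat.add_le_add_left (Finset.sum_le_sum_of_subset ?_) _)
    intro u
    simp only [hs, Finset.mem_filter, Finset.mem_product, Finset.mem_range] at ht ⊢
    rintro ⟨⟨h1, h2⟩, h3⟩
    exact ⟨⟨⟨by omega, h2⟩, by omega⟩, h3⟩
  obtain ⟨T, hT, h⟩ := exists_subset_sum_near (fun u : ℕ × ℕ => p ^ u.1 * q ^ u.2) (q ^ p) s
    hgreedy x (Nat.lt_of_succ_le (le_sum_rows hp hq (x + 1)))
  refine ⟨T, fun u hu => ?_, h⟩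
  have := hT hu
  simp only [hs, Finset.mem_filter, Finset.mem_product, Finset.mem_range] at this
  exact this.1.2

theorem exists_columns_near {p q : ℕ} (hp : 1 < p) (hq : 1 < q) (x : ℕ) :
    ∃ T : Finset (ℕ × ℕ), (∀ u ∈ T, u.1 < q) ∧ termSum p q T ≤ x ∧ x < termSum p q T + p ^ q := by
  obtain ⟨T, hT, h⟩ := exists_rows_near hq hp x
  have hsum : termSum p q (T.image Prod.swap) = termSum q p T := by
    unfold termSum
    rw [Finset.sum_image Prod.swap_injective.injOn]
    exact Finset.sum_congr rfl fun u _ => mul_comm _ _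
  refine ⟨T.image Prod.swap, fun u hu => ?_, by rwa [hsum]⟩
  obtain ⟨v, hv, rfl⟩ := Finset.mem_image.1 hu
  exact hT v hv

/-! ### Pairs of sums with a fixed difference -/

/-- The exponent pairs in rows `j ≥ p` and outside the square `[0, N) ^ 2`. -/
def Far (p N : ℕ) (u : ℕ × ℕ) : Prop := p ≤ u.2 ∧ (N ≤ u.1 ∨ N ≤ u.2)

/-- Far out there are two sums whose difference is a nonzero multiple of `q ^ p`, bounded
independently of how far out they lie. With `p ^ N * x = q ^ N * y + 1`, approximate the multiples
`n * x` by sums in rows and `n * y` by sums in columns; two values of `n` leave the same pair of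
remainders, so that their difference `k` satisfies
`k = p ^ N * (k * x) - q ^ N * (k * y)` with `k * x` and `k * y` differences of sums. -/
theorem exists_far_pair_le {p q : ℕ} (hp : 1 < p) (hq : 1 < q) (hpq : Nat.Coprime p q) {N : ℕ}
    (hN : p ≤ N) :
    ∃ k, 0 < k ∧ k ≤ q ^ p * p ^ q ∧ ∃ U V : Finset (ℕ × ℕ),
      (∀ u ∈ U, Far p N u) ∧ (∀ u ∈ V, Far p N u) ∧
      termSum p q V = termSum p q U + k * q ^ p := by
  obtain ⟨x, y, hxy⟩ : ∃ x y : ℕ, p ^ N * x = q ^ N * y + 1 := by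
    have hc : Nat.Coprime (p ^ N) (q ^ N) := Nat.Coprime.pow _ _ hpq
    have h1 : 1 < q ^ N := Nat.one_lt_pow (by omega) hq
    obtain ⟨x, -, hx⟩ := Nat.exists_mul_mod_eq_one_of_coprime hc h1
    refine ⟨x, p ^ N * x / q ^ N, ?_⟩
    rw [← hx]
    exact (Nat.div_add_mod _ _).symm
  choose R hR hR1 hR2 using fun n : ℕ => exists_rows_near hp hq (n * x)
  choose S hS hS1 hS2 using fun n : ℕ => exists_columns_near hp hq (n * y)
  obtain ⟨m, hm, n, hn, hmn, heq⟩ : ∃ m ∈ Finset.range (q ^ p * p ^ q + 1),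
      ∃ n ∈ Finset.range (q ^ p * p ^ q + 1), m ≠ n ∧
        (m * x - termSum p q (R m), m * y - termSum p q (S m)) =
          (n * x - termSum p q (R n), n * y - termSum p q (S n)) := by
    refine Finset.exists_ne_map_eq_of_card_lt_of_maps_to
      (t := Finset.range (q ^ p) ×ˢ Finset.range (p ^ q)) (by simp) fun n _ => ?_
    have h1 := hR1 n
    have h2 := hR2 n
    have h3 := hS1 n
    have h4 := hS2 n
    simp only [Finset.coe_product, Finset.coe_range, Set.mem_prod, Set.mem_Iio]
    omega
  wlog hlt : m < n generalizing m n
  · exact this n hn m hm hmn.symm heq.symm (by omega)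
  obtain ⟨e1, e2⟩ := Prod.ext_iff.1 heq
  simp only at e1 e2
  obtain ⟨k, rfl⟩ := Nat.exists_eq_add_of_lt hlt
  rw [Finset.mem_range] at hn
  have hx2 : (k + 1) * x + termSum p q (R m) = termSum p q (R (m + k + 1)) := by
    have h1 := hR1 m
    have h2 := hR1 (m + k + 1)
    have h3 : (m + k + 1) * x = m * x + (k + 1) * x := by ring
    omega
  have hy2 : (k + 1) * y + termSum p q (S m) = termSum p q (S (m + k + 1)) := by
    have h1 := hS1 m
    have h2 := hS1 (m + k + 1)
    have h3 : (m + k + 1) * y = m * y + (k + 1) * y := by ring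
    omega
  -- After translation the row sums use rows `j < 2 * p`, the column sums rows `j ≥ 2 * p`.
  have hfarR : ∀ n, ∀ u ∈ shift N p (R n), Far p N u ∧ u.2 < p + p := by
    intro n u hu
    obtain ⟨v, hv, h1, h2⟩ := mem_shift hu
    have := hR n v hv
    exact ⟨⟨by omega, Or.inl (by omega)⟩, by omega⟩
  have hfarS : ∀ n, ∀ u ∈ shift 0 (N + p) (S n), Far p N u ∧ p + p ≤ u.2 := by
    intro n u hu
    obtain ⟨v, hv, h1, h2⟩ := mem_shift hu
    exact ⟨⟨by omega, Or.inr (by omega)⟩, by omega⟩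
  have hdisj : ∀ m n, Disjoint (shift N p (R m)) (shift 0 (N + p) (S n)) := by
    intro m n
    refine Finset.disjoint_left.2 fun u h1 h2 => ?_
    have := (hfarR m u h1).2
    have := (hfarS n u h2).2
    omega
  refine ⟨k + 1, by omega, by omega, shift N p (R m) ∪ shift 0 (N + p) (S (m + k + 1)),
    shift N p (R (m + k + 1)) ∪ shift 0 (N + p) (S m), ?_, ?_, ?_⟩
  · intro u hu
    rcases Finset.mem_union.1 hu with h | h
    exacts [(hfarR _ u h).1, (hfarS _ u h).1]
  · intro u hu
    rcases Finset.mem_union.1 hu with h | h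
    exacts [(hfarR _ u h).1, (hfarS _ u h).1]
  · rw [termSum_union (hdisj _ _), termSum_union (hdisj _ _)]
    simp only [termSum_shift, ← hx2, ← hy2, pow_add, pow_zero, one_mul]
    linear_combination (k + 1) * q ^ p * hxy

/-- A single difference `d` occurs arbitrarily far out. -/
theorem exists_far_pair {p q : ℕ} (hp : 1 < p) (hq : 1 < q) (hpq : Nat.Coprime p q) :
    ∃ d, 0 < d ∧ ∀ N, ∃ U V : Finset (ℕ × ℕ), (∀ u ∈ U, Far p N u) ∧ (∀ u ∈ V, Far p N u) ∧
      termSum p q V = termSum p q U + d := by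
  by_contra! hcon
  choose! N hN using fun k (hk : 0 < k) => hcon (k * q ^ p) (by positivity)
  set N' := max p ((Finset.range (q ^ p * p ^ q + 1)).sup N) with hN'
  obtain ⟨k, hk0, hk, U, V, hU, hV, h⟩ := exists_far_pair_le hp hq hpq (le_max_left p _ : p ≤ N')
  have hle : N k ≤ N' := (Finset.le_sup (Finset.mem_range.2 (by omega))).trans (le_max_right _ _)
  have hfar : ∀ u, Far p N' u → Far p (N k) u := fun u hu =>
    ⟨hu.1, hu.2.imp hle.trans hle.trans⟩
  exact hN k hk0 U V (fun u hu => hfar u (hU u hu)) (fun u hu => hfar u (hV u hu)) h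

theorem exists_bound (T : Finset (ℕ × ℕ)) : ∃ N, ∀ u ∈ T, u.1 < N ∧ u.2 < N := by
  refine ⟨T.sup (fun u => u.1 + u.2) + 1, fun u hu => ?_⟩
  have : u.1 + u.2 ≤ _ := Finset.le_sup (f := fun u : ℕ × ℕ => u.1 + u.2) hu
  omega

/-- Independent pairs with difference `d` add up to a long arithmetic progression of sums. -/
theorem exists_far_progression {p q d : ℕ}
    (hd : ∀ N, ∃ U V : Finset (ℕ × ℕ), (∀ u ∈ U, Far p N u) ∧ (∀ u ∈ V, Far p N u) ∧
      termSum p q V = termSum p q U + d) (N m : ℕ) :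
    ∃ c N', ∀ l ≤ m, ∃ T : Finset (ℕ × ℕ), (∀ u ∈ T, Far p N u ∧ u.1 < N' ∧ u.2 < N') ∧
      termSum p q T = c + l * d := by
  induction m with
  | zero => exact ⟨0, 0, fun l hl => ⟨∅, by simp, by simp [termSum, Nat.le_zero.1 hl]⟩⟩
  | succ m ih =>
    obtain ⟨c, N₁, h⟩ := ih
    obtain ⟨U, V, hU, hV, hUV⟩ := hd (max N N₁)
    obtain ⟨N₂, hN₂⟩ := exists_bound (U ∪ V)
    have hext : ∀ T W : Finset (ℕ × ℕ), (∀ u ∈ T, Far p N u ∧ u.1 < N₁ ∧ u.2 < N₁) →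
        (∀ u ∈ W, Far p (max N N₁) u) → W ⊆ U ∪ V →
        (∀ u ∈ T ∪ W, Far p N u ∧ u.1 < max N₁ N₂ ∧ u.2 < max N₁ N₂) ∧
          termSum p q (T ∪ W) = termSum p q T + termSum p q W := by
      intro T W hT hW hWUV
      refine ⟨fun u hu => ?_, termSum_union (Finset.disjoint_left.2 fun u h1 h2 => ?_)⟩
      · rcases Finset.mem_union.1 hu with h1 | h1
        · have := hT u h1
          exact ⟨this.1, by omega, by omega⟩
        · obtain ⟨h2, h3⟩ := hW u h1
          have := hN₂ u (hWUV h1)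
          exact ⟨⟨h2, by omega⟩, by omega, by omega⟩
      · have h3 := hT u h1
        have h4 := (hW u h2).2
        omega
    refine ⟨c + termSum p q U, max N₁ N₂, fun l hl => ?_⟩
    rcases Nat.lt_or_ge m l with hlm | hlm
    · obtain ⟨T, hT, hTs⟩ := h m le_rfl
      obtain ⟨h1, h2⟩ := hext T V hT hV Finset.subset_union_right
      refine ⟨T ∪ V, h1, ?_⟩
      obtain rfl : l = m + 1 := by omega
      rw [h2, hTs, hUV]
      ring
    · obtain ⟨T, hT, hTs⟩ := h l hlm
      obtain ⟨h1, h2⟩ := hext T U hT hU Finset.subset_union_left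
      refine ⟨T ∪ U, h1, ?_⟩
      rw [h2, hTs]
      ring

/-! ### Residues and completeness -/

/-- Powers of `a` repeat modulo `d`, so any multiple of a suitable fixed power of `a` is congruent
to a sum of distinct powers of `a`. -/
theorem exists_sum_pow_modEq {a d : ℕ} (hd : 0 < d) :
    ∃ e E, ∀ n, ∃ s : Finset ℕ, (∀ i ∈ s, 0 < i ∧ i < E) ∧
      ∑ i ∈ s, a ^ i ≡ n * a ^ e [MOD d] := by
  obtain ⟨i, hi, j, hj, hij, h⟩ : ∃ i ∈ Finset.range (d + 1), ∃ j ∈ Finset.range (d + 1), i ≠ j ∧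
      a ^ (i + 1) % d = a ^ (j + 1) % d :=
    Finset.exists_ne_map_eq_of_card_lt_of_maps_to (t := Finset.range d) (by simp)
      fun n _ => by simpa using Nat.mod_lt _ hd
  wlog hlt : i < j generalizing i j
  · exact this j hj i hi hij.symm h.symm (by omega)
  obtain ⟨t, rfl⟩ := Nat.exists_eq_add_of_lt hlt
  have hper : ∀ m, a ^ (i + 1 + m * (t + 1)) ≡ a ^ (i + 1) [MOD d] := by
    intro m
    induction m with
    | zero => simpa using Nat.ModEq.refl _
    | succ m ih =>
      have h1 : a ^ (i + t + 1 + 1) ≡ a ^ (i + 1) [MOD d] := h.symm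
      calc a ^ (i + 1 + (m + 1) * (t + 1)) = a ^ (i + 1 + m * (t + 1)) * a ^ (t + 1) := by ring
        _ ≡ a ^ (i + 1) * a ^ (t + 1) [MOD d] := ih.mul_right _
        _ = a ^ (i + t + 1 + 1) := by ring
        _ ≡ _ [MOD d] := h1
  refine ⟨i + 1, i + 1 + d * (t + 1), fun n => ?_⟩
  refine ⟨(Finset.range (n % d)).image fun m => i + 1 + m * (t + 1), ?_, ?_⟩
  · intro k hk
    obtain ⟨m, hm, rfl⟩ := Finset.mem_image.1 hk
    have h1 : m < d := (Finset.mem_range.1 hm).trans (Nat.mod_lt _ hd)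
    have h2 : m * (t + 1) < d * (t + 1) := Nat.mul_lt_mul_of_pos_right h1 (by omega)
    omega
  · rw [Finset.sum_image fun m _ n _ h => by simpa using h]
    have h1 : ∑ m ∈ Finset.range (n % d), a ^ (i + 1 + m * (t + 1)) ≡
        ∑ m ∈ Finset.range (n % d), a ^ (i + 1) [MOD d] :=
      Nat.ModEq.sum fun m _ => hper m
    refine h1.trans ?_
    rw [Finset.sum_const, Finset.card_range, smul_eq_mul]
    exact (Nat.mod_modEq n d).mul_right _

theorem exists_termSum_modEq {p q d : ℕ} (hpq : Nat.Coprime p q) (hd : 0 < d) :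
    ∃ a, ∀ n, ∃ T : Finset (ℕ × ℕ), (∀ u ∈ T, u.1 < a ∧ u.2 < a) ∧ termSum p q T ≡ n [MOD d] := by
  obtain ⟨e₁, E₁, h₁⟩ := exists_sum_pow_modEq (a := p) hd
  obtain ⟨e₂, E₂, h₂⟩ := exists_sum_pow_modEq (a := q) hd
  refine ⟨max E₁ E₂ + 1, fun n => ?_⟩
  obtain ⟨x, y, hxy⟩ : ∃ x y : ℕ, x * p ^ e₁ + y * q ^ e₂ ≡ 1 [MOD d] := by
    have hc : IsCoprime ((p : ℤ) ^ e₁) ((q : ℤ) ^ e₂) :=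
      ((Nat.isCoprime_iff_coprime).2 hpq).pow
    obtain ⟨u, v, huv⟩ := hc
    have hd' : (d : ℤ) ≠ 0 := by positivity
    refine ⟨(u % d).toNat, (v % d).toNat, ?_⟩
    rw [← Int.natCast_modEq_iff]
    push_cast
    rw [Int.toNat_of_nonneg (Int.emod_nonneg _ hd'), Int.toNat_of_nonneg (Int.emod_nonneg _ hd'),
      ← huv]
    exact ((Int.mod_modEq u d).mul_right _).add ((Int.mod_modEq v d).mul_right _)
  obtain ⟨s, hs, hs'⟩ := h₁ (n * x)
  obtain ⟨t, ht, ht'⟩ := h₂ (n * y)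
  have hdisj : Disjoint (s.image fun i => (i, 0)) (t.image fun j => (0, j)) := by
    refine Finset.disjoint_left.2 fun u h1 h2 => ?_
    obtain ⟨i, hi, rfl⟩ := Finset.mem_image.1 h1
    obtain ⟨j, hj, h⟩ := Finset.mem_image.1 h2
    have := (hs i hi).1
    simp at h
    omega
  refine ⟨s.image (fun i => (i, 0)) ∪ t.image (fun j => (0, j)), fun u hu => ?_, ?_⟩
  · rcases Finset.mem_union.1 hu with h | h
    · obtain ⟨i, hi, rfl⟩ := Finset.mem_image.1 h
      have := hs i hi
      simp only
      omega
    · obtain ⟨i, hi, rfl⟩ := Finset.mem_image.1 h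
      have := ht i hi
      simp only
      omega
  · rw [termSum_union hdisj]
    have e1 : termSum p q (s.image fun i => (i, 0)) = ∑ i ∈ s, p ^ i := by
      rw [termSum, Finset.sum_image fun i _ j _ h => (Prod.ext_iff.1 h).1]
      simp
    have e2 : termSum p q (t.image fun j => (0, j)) = ∑ j ∈ t, q ^ j := by
      rw [termSum, Finset.sum_image fun i _ j _ h => (Prod.ext_iff.1 h).2]
      simp
    rw [e1, e2]
    refine (hs'.add ht').trans ?_
    have := hxy.mul_left n
    rw [mul_one] at this
    refine Eq.trans ?_ this
    ring_nf

/-- The theorem of Birch in Davenport's form: every large integer is a sum of distinct terms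
`p ^ i * q ^ j` with `j` bounded. Rows `j < p` approximate `n` from below up to a bounded error, a
bounded sum corrects the residue modulo `d`, and a progression with difference `d` does the
rest. -/
theorem exists_termSum_eq {p q : ℕ} (hp : 1 < p) (hq : 1 < q) (hpq : Nat.Coprime p q) :
    ∃ H N₀, ∀ n ≥ N₀, ∃ T : Finset (ℕ × ℕ), (∀ u ∈ T, u.2 < H) ∧ termSum p q T = n := by
  obtain ⟨d, hd, hfar⟩ := exists_far_pair hp hq hpq
  obtain ⟨a, ha⟩ := exists_termSum_modEq hpq hd
  set D := termSum p q (Finset.range a ×ˢ Finset.range a)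
  obtain ⟨c, N', hc⟩ := exists_far_progression hfar a (D + p ^ a * q ^ p)
  refine ⟨max p (max a N'), c + D, fun n hn => ?_⟩
  obtain ⟨B, hB, hB1, hB2⟩ := exists_rows_near hp hq ((n - c - D) / p ^ a)
  have hpa : 0 < p ^ a := by positivity
  have hB1' : p ^ a * termSum p q B ≤ n - c - D :=
    (Nat.mul_le_mul_left _ hB1).trans (Nat.mul_div_le _ _)
  have hB2' : n - c - D < p ^ a * termSum p q B + p ^ a * q ^ p := by
    rw [← mul_add, mul_comm]
    exact (Nat.div_lt_iff_lt_mul hpa).1 hB2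
  obtain ⟨W, hW, hWn⟩ := ha (n - c - p ^ a * termSum p q B)
  have hWD : termSum p q W ≤ D := by
    refine termSum_mono fun u hu => ?_
    simpa using hW u hu
  obtain ⟨l, hl⟩ := (Nat.modEq_iff_dvd' (by omega)).1 hWn
  have hlm : l ≤ d * l := Nat.le_mul_of_pos_left _ hd
  obtain ⟨T, hT, hTs⟩ := hc l (by omega)
  have hBs : ∀ u ∈ shift a 0 B, a ≤ u.1 ∧ u.2 < p := by
    intro u hu
    obtain ⟨v, hv, h1, h2⟩ := mem_shift hu
    have := hB v hv
    omega
  have hd1 : Disjoint (shift a 0 B) W := Finset.disjoint_left.2 fun u h1 h2 => by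
    have := hBs u h1
    have := hW u h2
    omega
  have hd2 : Disjoint (shift a 0 B ∪ W) T := Finset.disjoint_left.2 fun u h1 h2 => by
    obtain ⟨⟨h3, h4⟩, -⟩ := hT u h2
    rcases Finset.mem_union.1 h1 with h | h
    · have := hBs u h
      omega
    · have := hW u h
      omega
  refine ⟨(shift a 0 B ∪ W) ∪ T, fun u hu => ?_, ?_⟩
  · rcases Finset.mem_union.1 hu with h | h
    · rcases Finset.mem_union.1 h with h | h
      · have := hBs u h
        omega
      · have := hW u h
        omega
    · have := hT u h
      omega
  · rw [termSum_union hd2, termSum_union hd1, termSum_shift, hTs, pow_zero, mul_one, mul_comm l d]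
    omega

/-! ### Counting -/

theorem pow_mul_pow_injective {p q : ℕ} (hp : 1 < p) (hq : 1 < q) (hpq : Nat.Coprime p q) :
    Function.Injective fun u : ℕ × ℕ => p ^ u.1 * q ^ u.2 := by
  rintro ⟨a, b⟩ ⟨c, d⟩ h
  simp only at h
  have h1 : p ^ a = p ^ c := by
    apply Nat.dvd_antisymm
    · exact (Nat.Coprime.pow a d hpq).dvd_of_dvd_mul_right (h ▸ Dvd.intro _ rfl)
    · exact (Nat.Coprime.pow c b hpq).dvd_of_dvd_mul_right (h.symm ▸ Dvd.intro _ rfl)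
  have h2 : q ^ b = q ^ d := by
    rw [h1] at h
    exact Nat.eq_of_mul_eq_mul_left (by positivity) h
  rw [Nat.pow_right_injective hp h1, Nat.pow_right_injective hq h2]

theorem reprCount_eq_ncard {p q : ℕ} (hp : 1 < p) (hq : 1 < q) (hpq : Nat.Coprime p q) (n : ℕ) :
    reprCount p q n = {T : Finset (ℕ × ℕ) | termSum p q T = n}.ncard := by
  have hinj := pow_mul_pow_injective hp hq hpq
  rw [reprCount, ← Set.ncard_image_of_injective _ (Finset.image_injective hinj)]
  congr 1
  ext S
  constructor
  · rintro ⟨h1, h2⟩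
    choose! a b hab using h1
    have hS : (S.image fun m => (a m, b m)).image (fun u : ℕ × ℕ => p ^ u.1 * q ^ u.2) = S := by
      rw [Finset.image_image]
      exact (Finset.image_congr fun m hm => (hab m hm).symm).trans Finset.image_id
    refine ⟨_, ?_, hS⟩
    rw [Set.mem_ofPred_eq, ← h2, termSum]
    conv_rhs => rw [← hS]
    rw [Finset.sum_image hinj.injOn]
  · rintro ⟨T, hT, rfl⟩
    refine ⟨fun m hm => ?_, ?_⟩
    · obtain ⟨u, -, rfl⟩ := Finset.mem_image.1 hm
      exact ⟨u.1, u.2, rfl⟩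
    · rw [Finset.sum_image hinj.injOn]
      exact hT

theorem finite_setOf_termSum_eq {p q : ℕ} (hp : 1 < p) (hq : 1 < q) (hpq : Nat.Coprime p q)
    (n : ℕ) : {T : Finset (ℕ × ℕ) | termSum p q T = n}.Finite := by
  have hinj := pow_mul_pow_injective hp hq hpq
  refine ((representations_finite p q n).preimage
    (Finset.image_injective hinj).injOn).subset fun T hT => ⟨fun m hm => ?_, ?_⟩
  · obtain ⟨u, -, rfl⟩ := Finset.mem_image.1 hm
    exact ⟨u.1, u.2, rfl⟩
  · rw [Finset.sum_image hinj.injOn]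
    exact hT

/-- The number of terms `p ^ i * q ^ j` at most `n` in row `j`, provided that `q ^ j ≤ n`. -/
def rowLength (p q n j : ℕ) : ℕ := Nat.log p (n / q ^ j) + 1

theorem reprCount_le {p q n : ℕ} (hp : 1 < p) (hq : 1 < q) (hpq : Nat.Coprime p q) :
    reprCount p q n ≤ 2 ^ ∑ j ∈ Finset.range (Nat.log q n + 1), rowLength p q n j := by
  rw [reprCount_eq_ncard hp hq hpq]
  set G : Finset (Σ _ : ℕ, ℕ) :=
    (Finset.range (Nat.log q n + 1)).sigma fun j => Finset.range (rowLength p q n j) with hG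
  set F : Finset (ℕ × ℕ) := G.image fun x => (x.2, x.1) with hF
  have hsub : {T : Finset (ℕ × ℕ) | termSum p q T = n} ⊆ (F.powerset : Set (Finset (ℕ × ℕ))) := by
    intro T hT
    rw [Finset.mem_coe, Finset.mem_powerset]
    rintro ⟨i, j⟩ hu
    have hle : p ^ i * q ^ j ≤ n :=
      (Finset.single_le_sum (f := fun u : ℕ × ℕ => p ^ u.1 * q ^ u.2)
        (fun _ _ => Nat.zero_le _) hu).trans_eq hT
    have hqj : 0 < q ^ j := by positivity
    have hpi : 0 < p ^ i := by positivity
    have h1 : q ^ j ≤ n := (Nat.le_mul_of_pos_left _ hpi).trans hle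
    have h2 : p ^ i ≤ n / q ^ j := (Nat.le_div_iff_mul_le hqj).2 hle
    refine Finset.mem_image.2 ⟨⟨j, i⟩, ?_, rfl⟩
    simp only [hG, Finset.mem_sigma, Finset.mem_range, rowLength]
    exact ⟨Nat.lt_succ_of_le (Nat.le_log_of_pow_le hq h1),
      Nat.lt_succ_of_le (Nat.le_log_of_pow_le hp h2)⟩
  calc _ ≤ (F.powerset : Set (Finset (ℕ × ℕ))).ncard :=
        Set.ncard_le_ncard hsub (Finset.finite_toSet _)
    _ = 2 ^ F.card := by rw [Set.ncard_coe_finset, Finset.card_powerset]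
    _ ≤ 2 ^ G.card := Nat.pow_le_pow_right (by norm_num) Finset.card_image_le
    _ = _ := by simp [hG, Finset.card_sigma]

/-- Terms in rows `j ≥ H` may be chosen freely, as long as terms in rows `j < H` can represent what
remains of `n`. -/
theorem two_pow_card_le_reprCount {p q : ℕ} (hp : 1 < p) (hq : 1 < q) (hpq : Nat.Coprime p q)
    {H N₀ n : ℕ} (hB : ∀ n ≥ N₀, ∃ T : Finset (ℕ × ℕ), (∀ u ∈ T, u.2 < H) ∧ termSum p q T = n)
    {F : Finset (ℕ × ℕ)} (hF : ∀ u ∈ F, H ≤ u.2) (hn : termSum p q F + N₀ ≤ n) :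
    2 ^ F.card ≤ reprCount p q n := by
  rw [reprCount_eq_ncard hp hq hpq, ← Finset.card_powerset, ← Set.ncard_coe_finset]
  choose! T hT hTs using hB
  have hle : ∀ X ⊆ F, termSum p q X + N₀ ≤ n := fun X hX =>
    (Nat.add_le_add_right (termSum_mono hX) _).trans hn
  have hfilter : ∀ X ⊆ F, (X ∪ T (n - termSum p q X)).filter (fun u => H ≤ u.2) = X := by
    intro X hX
    have := hle X hX
    ext u
    simp only [Finset.mem_filter, Finset.mem_union]
    refine ⟨fun ⟨h1, h2⟩ => h1.resolve_right fun h3 => ?_, fun h => ⟨Or.inl h, hF u (hX h)⟩⟩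
    have := hT (n - termSum p q X) (by omega) u h3
    omega
  refine Set.ncard_le_ncard_of_injOn (fun X => X ∪ T (n - termSum p q X)) ?_ ?_
    (finite_setOf_termSum_eq hp hq hpq n)
  · intro X hX
    have hX' : X ⊆ F := by simpa using hX
    have := hle X hX'
    have hdisj : Disjoint X (T (n - termSum p q X)) := Finset.disjoint_left.2 fun u h1 h2 => by
      have := hT (n - termSum p q X) (by omega) u h2
      have := hF u (hX' h1)
      omega
    rw [Set.mem_ofPred_eq, termSum_union hdisj, hTs _ (by omega)]
    omega
  · intro X hX Y hY h
    rw [← hfilter X (by simpa using hX), ← hfilter Y (by simpa using hY)]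
    exact congrArg _ h

/-- Lengthening row `j` by `j / D` still leaves a total of `O(n)` when `q₂` is replaced by `q₁`,
since `p ^ (1 / D) * q₁ < q₂` makes the row sums decay geometrically; discarding the last `A` terms
of each row turns `O(n)` into `n / 2`. -/
theorem exists_rows_sum_le {p q₁ q₂ : ℕ} (hp : 1 < p) (hq₁ : 0 < q₁) (hq : q₁ < q₂) (H : ℕ) :
    ∃ D A : ℕ, 0 < D ∧ ∀ n, 0 < n → 2 * ∑ j ∈ Finset.range (Nat.log q₂ n + 1),
      (∑ i ∈ Finset.range (rowLength p q₂ n j + j / D - A), p ^ i * q₁ ^ (j + H)) ≤ n := by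
  have hq₁' : (0 : ℝ) < q₁ := by exact_mod_cast hq₁
  have hq₂' : (0 : ℝ) < q₂ := by exact_mod_cast hq₁.trans hq
  have hp' : (1 : ℝ) < p := by exact_mod_cast hp
  have h1 : (1 : ℝ) < q₂ / q₁ := by
    rw [one_lt_div hq₁']
    exact_mod_cast hq
  obtain ⟨D, hD⟩ := pow_unbounded_of_one_lt (p : ℝ) h1
  have hD0 : D ≠ 0 := by
    rintro rfl
    rw [pow_zero] at hD
    linarith
  -- The ratio `r = p ^ (1 / D) * q₁ / q₂ < 1` governs the decay of the row sums.
  obtain ⟨β, hβ0, hβ⟩ : ∃ β : ℝ, 0 ≤ β ∧ β ^ D = p :=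
    ⟨(p : ℝ) ^ (1 / (D : ℝ)), by positivity, by
      rw [one_div]
      exact Real.rpow_inv_natCast_pow (by positivity) hD0⟩
  have hβ1 : 1 ≤ β := by
    by_contra! h
    have := pow_lt_one₀ hβ0 h hD0
    linarith
  have hβ2 : β < q₂ / q₁ := lt_of_pow_lt_pow_left₀ D (by positivity) (hβ ▸ hD)
  set r : ℝ := β * q₁ / q₂ with hr
  have hr0 : 0 ≤ r := by positivity
  have hr1 : r < 1 := by
    rw [hr, div_lt_one hq₂']
    exact (lt_div_iff₀ hq₁').1 hβ2
  obtain ⟨A, hA⟩ := pow_unbounded_of_one_lt (2 * p * q₁ ^ H / (1 - r) : ℝ) hp'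
  refine ⟨D, A, Nat.pos_of_ne_zero hD0, fun n hn0 => ?_⟩
  have hrow : ∀ j ∈ Finset.range (Nat.log q₂ n + 1),
      (p : ℝ) ^ A * ((∑ i ∈ Finset.range (rowLength p q₂ n j + j / D - A),
        p ^ i * q₁ ^ (j + H) : ℕ) : ℝ) ≤ n * p * q₁ ^ H * r ^ j := by
    intro j hj
    set m := rowLength p q₂ n j + j / D - A with hm
    rcases Nat.eq_zero_or_pos m with hm0 | hm0
    · rw [hm0]
      simp only [Finset.range_zero, Finset.sum_empty, Nat.cast_zero, mul_zero]
      positivity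
    have hgeom : ∑ i ∈ Finset.range m, p ^ i ≤ p ^ m := (Nat.geomSum_lt hp (by simp)).le
    have hdiv : p ^ Nat.log p (n / q₂ ^ j) * q₂ ^ j ≤ n := by
      have hn : q₂ ^ j ≤ n :=
        Nat.pow_le_of_le_log hn0.ne' (Nat.lt_succ_iff.1 (Finset.mem_range.1 hj))
      have hqj : 0 < q₂ ^ j := pow_pos (hq₁.trans hq) _
      rw [← Nat.le_div_iff_mul_le hqj]
      exact Nat.pow_log_le_self _ (Nat.div_pos hn hqj).ne'
    have hβj : (p : ℝ) ^ (j / D) ≤ β ^ j := by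
      rw [← hβ, ← pow_mul]
      exact pow_le_pow_right₀ hβ1 (Nat.mul_div_le _ _)
    -- The subtraction in `m` does not truncate, as `m` is positive.
    have hpm : p ^ A * p ^ m = p ^ Nat.log p (n / q₂ ^ j) * p * p ^ (j / D) := by
      rw [← pow_add, ← pow_succ, ← pow_add]
      congr 1
      rw [rowLength] at hm
      omega
    rw [← Finset.sum_mul]
    have hdiv' : (p : ℝ) ^ Nat.log p (n / q₂ ^ j) * q₂ ^ j ≤ n := by exact_mod_cast hdiv
    have hpm' : (p : ℝ) ^ A * p ^ m = p ^ Nat.log p (n / q₂ ^ j) * p * p ^ (j / D) := by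
      exact_mod_cast hpm
    have hgeom' : ((∑ i ∈ Finset.range m, p ^ i : ℕ) : ℝ) ≤ p ^ m := by exact_mod_cast hgeom
    have hrj : r ^ j * q₂ ^ j = β ^ j * q₁ ^ j := by
      rw [← mul_pow, ← mul_pow, hr, div_mul_cancel₀ _ hq₂'.ne']
    refine le_of_mul_le_mul_right ?_ (pow_pos hq₂' j)
    push_cast at hgeom' ⊢
    calc (p : ℝ) ^ A * ((∑ i ∈ Finset.range m, (p : ℝ) ^ i) * q₁ ^ (j + H)) * q₂ ^ j
        ≤ (p : ℝ) ^ A * ((p : ℝ) ^ m * q₁ ^ (j + H)) * q₂ ^ j := by gcongr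
      _ = ((p : ℝ) ^ Nat.log p (n / q₂ ^ j) * q₂ ^ j) * p * p ^ (j / D) * q₁ ^ (j + H) := by
        linear_combination ((q₁ : ℝ) ^ (j + H) * q₂ ^ j) * hpm'
      _ ≤ n * p * β ^ j * q₁ ^ (j + H) := by gcongr
      _ = n * p * q₁ ^ H * r ^ j * q₂ ^ j := by
        rw [pow_add]
        linear_combination (-(n * p * q₁ ^ H : ℝ)) * hrj
  have hsum := Finset.sum_le_sum hrow
  rw [← Finset.mul_sum, ← Finset.mul_sum] at hsum
  have hgs : ∑ j ∈ Finset.range (Nat.log q₂ n + 1), r ^ j ≤ 1 / (1 - r) := by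
    rw [le_div_iff₀ (by linarith), geom_sum_mul_neg]
    linarith [pow_nonneg hr0 (Nat.log q₂ n + 1)]
  have hfin : (p : ℝ) ^ A * ((2 * ∑ j ∈ Finset.range (Nat.log q₂ n + 1),
      (∑ i ∈ Finset.range (rowLength p q₂ n j + j / D - A), p ^ i * q₁ ^ (j + H)) : ℕ) : ℝ) ≤
      p ^ A * n := by
    rw [Nat.cast_mul, Nat.cast_sum]
    calc _ = 2 * ((p : ℝ) ^ A * ∑ j ∈ Finset.range (Nat.log q₂ n + 1),
        ((∑ i ∈ Finset.range (rowLength p q₂ n j + j / D - A), p ^ i * q₁ ^ (j + H) : ℕ) : ℝ)) := by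
          push_cast
          ring
      _ ≤ 2 * (n * p * q₁ ^ H * (1 / (1 - r))) := by
        refine mul_le_mul_of_nonneg_left (hsum.trans ?_) (by norm_num)
        gcongr
      _ = (2 * p * q₁ ^ H / (1 - r)) * n := by ring
      _ ≤ p ^ A * n := by gcongr
  exact_mod_cast le_of_mul_le_mul_left hfin (by positivity)

theorem linear_le_sum_div (D A J : ℕ) (hD : 0 < D) :
    (A + 1) * J ≤ ∑ j ∈ Finset.range J, j / D + (A + 1) * (D * (A + 1)) := by
  induction J with
  | zero => simp
  | succ J ih =>
    rw [Finset.sum_range_succ]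
    rcases Nat.lt_or_ge J (D * (A + 1)) with h | h
    · have : (A + 1) * (J + 1) ≤ (A + 1) * (D * (A + 1)) := Nat.mul_le_mul_left _ h
      exact this.trans (Nat.le_add_left _ _)
    · have : A + 1 ≤ J / D := (Nat.le_div_iff_mul_le hD).2 (by rwa [mul_comm])
      rw [mul_add, mul_one]
      omega

/-- The counts differ at least by a factor exponential in `log n`. -/
theorem exists_mul_reprCount_le {p q₁ q₂ : ℕ} (hp : 1 < p) (hq₁ : 1 < q₁) (hq : q₁ < q₂)
    (h₁ : Nat.Coprime p q₁) (h₂ : Nat.Coprime p q₂) :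
    ∃ K N, ∀ n ≥ N, 0 < reprCount p q₁ n ∧
      2 ^ Nat.log q₂ n * reprCount p q₂ n ≤ 2 ^ K * reprCount p q₁ n := by
  obtain ⟨H, N₀, hB⟩ := exists_termSum_eq hp hq₁ h₁
  obtain ⟨D, A, hD, hsum⟩ := exists_rows_sum_le hp (by omega : 0 < q₁) hq H
  refine ⟨(A + 1) * (D * (A + 1)), 2 * N₀ + 1, fun n hn => ?_⟩
  set J := Nat.log q₂ n + 1 with hJ
  set m : ℕ → ℕ := fun j => rowLength p q₂ n j + j / D - A with hm
  set F : Finset (ℕ × ℕ) := ((Finset.range J).sigma fun j => Finset.range (m j)).image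
    (fun x : Σ _ : ℕ, ℕ => (x.2, x.1 + H)) with hF
  have hinj : Function.Injective (fun x : Σ _ : ℕ, ℕ => (x.2, x.1 + H)) := by
    rintro ⟨a, b⟩ ⟨c, d⟩ h
    simp only [Prod.mk.injEq, Nat.add_right_cancel_iff] at h
    obtain ⟨rfl, rfl⟩ := h
    rfl
  have hcard : F.card = ∑ j ∈ Finset.range J, m j := by
    rw [hF, Finset.card_image_of_injective _ hinj, Finset.card_sigma]
    simp
  have hFsum : 2 * termSum p q₁ F ≤ n := by
    rw [termSum, hF, Finset.sum_image hinj.injOn, Finset.sum_sigma]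
    exact hsum n (by omega)
  have hlow := two_pow_card_le_reprCount hp hq₁ h₁ hB (F := F) (n := n) (fun u hu => by
    obtain ⟨x, -, rfl⟩ := Finset.mem_image.1 hu
    exact Nat.le_add_left _ _) (by omega)
  refine ⟨lt_of_lt_of_le (by positivity) hlow, ?_⟩
  have hup := reprCount_le (n := n) hp (hq₁.trans hq) h₂
  have hcmp : ∑ j ∈ Finset.range J, rowLength p q₂ n j + ∑ j ∈ Finset.range J, j / D ≤
      ∑ j ∈ Finset.range J, m j + A * J := by
    have : A * J = ∑ j ∈ Finset.range J, A := by simp [mul_comm]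
    rw [this, ← Finset.sum_add_distrib, ← Finset.sum_add_distrib]
    refine Finset.sum_le_sum fun j _ => ?_
    simp only [hm]
    omega
  have hlin := linear_le_sum_div D A J hD
  rw [add_mul, one_mul] at hlin
  calc 2 ^ Nat.log q₂ n * reprCount p q₂ n
      ≤ 2 ^ Nat.log q₂ n * 2 ^ ∑ j ∈ Finset.range J, rowLength p q₂ n j :=
        Nat.mul_le_mul_left _ hup
    _ ≤ 2 ^ ((A + 1) * (D * (A + 1))) * 2 ^ F.card := by
      rw [← pow_add, ← pow_add, hcard]
      exact Nat.pow_le_pow_right (by norm_num) (by omega)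
    _ ≤ _ := Nat.mul_le_mul_left _ hlow

theorem corollary2 (p q₁ q₂ : ℕ) (hp : 1 < p) (hpq : p < q₁) (hq : q₁ < q₂)
    (h₁ : Nat.gcd p q₁ = 1) (h₂ : Nat.gcd p q₂ = 1) :
    Tendsto (fun n : ℕ => (reprCount p q₂ n : ℝ) / (reprCount p q₁ n : ℝ)) atTop (𝓝 0) ∧
      ∀ᶠ n : ℕ in atTop, reprCount p q₂ n < reprCount p q₁ n := by
  obtain ⟨K, N, h⟩ := exists_mul_reprCount_le hp (hp.trans hpq) hq h₁ h₂
  have hlog : Tendsto (fun n => Nat.log q₂ n) atTop atTop :=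
    tendsto_atTop_atTop.2 fun b => ⟨q₂ ^ b, fun n hn => Nat.le_log_of_pow_le (by omega) hn⟩
  refine ⟨?_, ?_⟩
  · have hlim : Tendsto (fun n => (2 : ℝ) ^ K * (1 / 2) ^ Nat.log q₂ n) atTop (𝓝 0) := by
      simpa using ((tendsto_pow_atTop_nhds_zero_of_lt_one (by norm_num : (0 : ℝ) ≤ 1 / 2)
        (by norm_num)).comp hlog).const_mul ((2 : ℝ) ^ K)
    refine squeeze_zero' (Eventually.of_forall fun n => by positivity) ?_ hlim
    filter_upwards [eventually_ge_atTop N] with n hn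
    obtain ⟨h0, hle⟩ := h n hn
    have h0' : (0 : ℝ) < reprCount p q₁ n := by exact_mod_cast h0
    have hle' : (2 : ℝ) ^ Nat.log q₂ n * reprCount p q₂ n ≤ 2 ^ K * reprCount p q₁ n := by
      exact_mod_cast hle
    rw [div_le_iff₀ h0', one_div, inv_pow]
    have h2 : (0 : ℝ) < 2 ^ Nat.log q₂ n := by positivity
    rw [mul_right_comm, ← div_eq_mul_inv, le_div_iff₀ h2]
    linarith
  · filter_upwards [eventually_ge_atTop N, hlog.eventually_ge_atTop (K + 1)] with n hn hK
    obtain ⟨h0, hle⟩ := h n hn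
    have h2 : 2 ^ (K + 1) * reprCount p q₂ n ≤ 2 ^ K * reprCount p q₁ n :=
      (Nat.mul_le_mul_right _ (Nat.pow_le_pow_right (by norm_num) hK)).trans hle
    rw [pow_succ, mul_assoc] at h2
    have h3 := Nat.le_of_mul_le_mul_left h2 (by positivity)
    omega
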